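/- **Streams.** A circulation on a topological space $X$ assigns to each open $U\subset X$ a preorder $\leqslant_U$ on $U$ so that, for every collection $\mathcal O$ of open subsets, $\leqslant_{\bigcup\mathcal O}$ is the smallest preorder on $\bigcup\mathcal O$ whose graph contains the graphs of all $\leqslant_U$, $U\in\mathcal O$. A continuous map $f:X\to Y$ between spaces with circulations is a stream map if $x\leqslant_{f^{-1}U}y$ implies $f(x)\leqslant_U f(y)$ for all open $U\subset Y$. Let $\mathscr U$ be the category of weak Hausdorff k-streams and stream maps: spaces with circulation that are colimits of compact Hausdorff ones (in the category of all spaces with circulation and stream maps), and in which images of compact Hausdorff spaces are Hausdorff. The category $\mathscr U$ has pullbacks and is Cartesian closed; write $X^{Y}$ for its exponentials. A Hausdorff k-space, such as $\mathbb I=[0,1]$ or $\mathbb R_+=[0,\infty)$, is regarded as an object of $\mathscr U$ with the circulation $x\leqslant_U y\iff x=y\in U$. For a small category $\mathcal G$, a $\mathcal G$-stream is a functor $\mathcal G\to\mathscr U$ and a $\mathcal G$-stream map is a natural transformation; objects of $\mathscr U$ are regarded as constant $\mathcal G$-streams. **h-fibrations.** A $\mathcal G$-stream map $f$ is an h-fibration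 if it has the right lifting property against $X\times(\{0\}\hookrightarrow\mathbb I)$ for every $\mathcal G$-stream $X$. **Moore paths.** For $X\in\mathscr U$ let $\Pi X$ be the pullback in $\mathscr U$ of the map $X^{\mathbb R_+}\times\mathbb R_+\to X^{\mathbb R_+}$, $(\zeta,t)\mapsto\zeta(\max(-,t))$, and the map $X\to X^{\mathbb R_+}$ sending a point to the constant path at it; thus $\Pi X$ consists of the pairs $(\zeta,t)$ with $\zeta:\mathbb R_+\to X$ constant on $[t,\infty)$. Let $\mathrm{dom}_{\Pi X},\mathrm{cod}_{\Pi X}:\Pi X\to X$ and $\mathrm{id}_{\Pi X}:X\to\Pi X$ be given by $(\zeta,t)\mapsto\zeta(0)$, $(\zeta,t)\mapsto\zeta(t)$, and $x\mapsto(\mathrm{const}_x,0)$. Extend $\Pi$, $\mathrm{dom}$, $\mathrm{cod}$, $\mathrm{id}$ objectwise to $\mathcal G$-streams. **The pointed endofunctor $\Gamma$.** For a $\mathcal G$-stream map $f:X\to Y$ let $X\times_f\Pi Y$ be the pullback of $f$ along $\mathrm{dom}_{\Pi Y}$, let $\Gamma f:X\times_f\Pi Y\to Y$ be the projection to $\Pi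 Y$ followed by $\mathrm{cod}_{\Pi Y}$, and let $Lf:X\to X\times_f\Pi Y$ be the map with components $1_X$ and $\mathrm{id}_{\Pi Y}\circ f$. Then $\Gamma$ is an endofunctor of the arrow category of $\mathcal G$-streams, pointed by the natural transformation $\eta$ with $\eta_f=(Lf,1_Y):f\to\Gamma f$. An algebra over the pointed endofunctor $\Gamma$ with underlying object $f$ is a morphism $a:\Gamma f\to f$ of the arrow category with $a\circ\eta_f=1_f$. **Theorem.** For every small category $\mathcal G$ and every $\mathcal G$-stream map $f$, the following are equivalent: 1. $f$ is an h-fibration; 2. $f$ underlies an algebra over the pointed endofunctor $\Gamma$. -/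

import Mathlib

open CategoryTheory MonoidalCategory CartesianMonoidalCategory Limits TopologicalSpace
open scoped NNReal

universe w v u

noncomputable section

namespace Streams

/-! ## Circulations, streams and stream maps -/

/-- A circulation on a space `X`: a preorder `le U` on every open subset `U` (a relation on `X`
supported on `U`), such that the preorder on a union of open subsets is the smallest preorder
containing the preorders on the members.  Every `le U` being reflexive on `U`, that smallest
preorder is the transitive closure of the union of the graphs. -/
@[ext]
structure Circulation (X : Type u) [TopologicalSpace X] where
  le : Opens X → X → X → Prop
  mem_of_le : ∀ {U : Opens X} {x y : X}, le U x y → x ∈ U ∧ y ∈ U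
  refl : ∀ {U : Opens X} {x : X}, x ∈ U → le U x x
  trans : ∀ {U : Opens X} {x y z : X}, le U x y → le U y z → le U x z
  le_sSup_iff : ∀ (𝒪 : Set (Opens X)) (x y : X),
    le (sSup 𝒪) x y ↔ Relation.TransGen (fun a b => ∃ U ∈ 𝒪, le U a b) x y

/-- The initial circulation: `x ≤_U y` if and only if `x = y ∈ U`. -/
def Circulation.initial (X : Type u) [TopologicalSpace X] : Circulation X where
  le U x y := x = y ∧ x ∈ U
  mem_of_le := by rintro U x _ ⟨rfl, h⟩; exact ⟨h, h⟩
  refl h := ⟨rfl, h⟩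
  trans := by rintro U x _ _ ⟨rfl, h⟩ ⟨rfl, _⟩; exact ⟨rfl, h⟩
  le_sSup_iff 𝒪 x y := by
    constructor
    · rintro ⟨rfl, h⟩
      obtain ⟨U, hU, hx⟩ := Opens.mem_sSup.1 h
      exact .single ⟨U, hU, rfl, hx⟩
    · intro h
      induction h with
      | single h =>
        obtain ⟨U, hU, rfl, hx⟩ := h
        exact ⟨rfl, Opens.mem_sSup.2 ⟨U, hU, hx⟩⟩
      | tail _ h ih =>
        obtain ⟨U, hU, rfl, hx⟩ := h
        exact ih

theorem Circulation.mono {X : Type u} [TopologicalSpace X] (c : Circulation X) {U V : Opens X}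
    (h : U ≤ V) {x y : X} (hxy : c.le U x y) : c.le V x y := by
  have : V = sSup {U, V} := by simp [h]
  rw [this, c.le_sSup_iff]
  exact .single ⟨U, by simp, hxy⟩

/-- A stream: a space with a circulation on it. -/
structure Strm where
  carrier : Type u
  [top : TopologicalSpace carrier]
  circ : Circulation carrier

instance : CoeSort Strm.{u} (Type u) := ⟨Strm.carrier⟩

instance (X : Strm.{u}) : TopologicalSpace X := X.top

/-- Stream maps: continuous maps `f` such that `x ≤_{f⁻¹ U} y` implies `f x ≤_U f y`. -/
structure IsStreamMap {X Y : Strm.{u}} (f : X → Y) : Prop where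
  continuous : Continuous f
  monotone : ∀ (U : Opens Y) (x y : X),
    X.circ.le ⟨f ⁻¹' U, U.isOpen.preimage continuous⟩ x y → Y.circ.le U (f x) (f y)

theorem IsStreamMap.id (X : Strm.{u}) : IsStreamMap (fun x : X => x) :=
  ⟨continuous_id, fun _ _ _ h => h⟩

theorem IsStreamMap.comp {X Y Z : Strm.{u}} {g : Y → Z} {f : X → Y} (hg : IsStreamMap g)
    (hf : IsStreamMap f) : IsStreamMap (fun x => g (f x)) :=
  ⟨hg.continuous.comp hf.continuous, fun U _ _ h => hg.monotone U _ _ (hf.monotone _ _ _ h)⟩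

theorem IsStreamMap.const {X Y : Strm.{u}} (y : Y) : IsStreamMap (fun _ : X => y) :=
  ⟨continuous_const, fun _ _ _ h => Y.circ.refl (X.circ.mem_of_le h).1⟩

/-- The type of stream maps. -/
@[ext]
structure Strm.Hom (X Y : Strm.{u}) where
  toFun : X → Y
  isStreamMap : IsStreamMap toFun

/-- The category of all streams. -/
instance : Category Strm.{u} where
  Hom := Strm.Hom
  id X := ⟨fun x => x, .id X⟩
  comp f g := ⟨fun x => g.toFun (f.toFun x), g.isStreamMap.comp f.isStreamMap⟩

/-- A stream whose underlying space is compact Hausdorff. -/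
def IsCH (X : Strm.{u}) : Prop := CompactSpace X ∧ T2Space X

/-- A k-stream: a (small) colimit, in the category of all streams, of compact Hausdorff
streams. -/
def IsKStream (X : Strm.{u}) : Prop :=
  ∃ (J : Type u) (_ : SmallCategory J) (p : ColimitPresentation J X), ∀ j, IsCH (p.diag.obj j)

/-- A space is weak Hausdorff if the images in it of compact Hausdorff spaces are Hausdorff. -/
def WeakHausdorff (X : Type u) [TopologicalSpace X] : Prop :=
  ∀ (K : Type u) [TopologicalSpace K] [CompactSpace K] [T2Space K] (f : K → X),
    Continuous f → T2Space (Set.range f)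

/-- The category of weak Hausdorff k-streams and stream maps. -/
abbrev 𝒰 : Type (u + 1) :=
  ObjectProperty.FullSubcategory (fun X : Strm.{u} => IsKStream X ∧ WeakHausdorff X)

/-! ## Streams defined by families of plots

The limits and the mapping streams of `𝒰` are built as final structures: a set together with a
family of functions ("plots") to it from compact Hausdorff streams receives the finest topology and
the smallest circulation making these functions stream maps. -/

/-- The one-point stream. -/
def pt : Strm.{u} := ⟨PUnit, .initial _⟩

theorem pt_isCH : IsCH pt.{u} :=
  ⟨inferInstanceAs (CompactSpace PUnit), inferInstanceAs (T2Space PUnit)⟩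

/-- A family of plots, containing the points. -/
structure Plots (Z : Type u) where
  adm : (K : Strm.{u}) → (K → Z) → Prop
  const : ∀ z, adm pt (fun _ => z)

namespace Plots

variable {Z : Type u} (P : Plots Z)

/-- The final topology for a family of plots. -/
@[reducible]
def topology : TopologicalSpace Z where
  IsOpen A := ∀ (K : Strm.{u}) (p : K → Z), IsCH K → P.adm K p → IsOpen (p ⁻¹' A)
  isOpen_univ := fun _ _ _ _ => isOpen_univ
  isOpen_inter := fun _ _ hA hB K p hK hp => (hA K p hK hp).inter (hB K p hK hp)
  isOpen_sUnion := fun S hS K p hK hp => by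
    rw [Set.preimage_sUnion]
    exact isOpen_biUnion fun A hA => hS A hA K p hK hp

/-- The relations `p a ≤_A p b` imposed by `a ≤_{p⁻¹ A} b` for the plots `p`. -/
def gen (A : letI := P.topology; Opens Z) (x y : Z) : Prop :=
  letI := P.topology
  ∃ (K : Strm.{u}) (p : K → Z) (hK : IsCH K) (hp : P.adm K p) (a b : K),
    K.circ.le ⟨p ⁻¹' A.1, A.2 K p hK hp⟩ a b ∧ p a = x ∧ p b = y

/-- The stream given by the final topology and the final circulation. -/
def stream : Strm.{u} :=
  letI := P.topology
  { carrier := Z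
    top := P.topology
    circ :=
      { le := fun A => Relation.TransGen (P.gen A)
        mem_of_le := by
          intro _ x y h
          have key : ∀ {A x y}, P.gen A x y → x ∈ A ∧ y ∈ A := by
            rintro _ _ _ ⟨K, p, hK, hp, a, b, h, rfl, rfl⟩
            exact K.circ.mem_of_le h
          induction h with
          | single h => exact key h
          | tail _ h ih => exact ⟨ih.1, (key h).2⟩
        refl := fun {A x} hx => .single
          ⟨pt, fun _ => x, pt_isCH, P.const x, PUnit.unit, PUnit.unit, ⟨rfl, hx⟩, rfl, rfl⟩
        trans := fun h h' => h.trans h'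
        le_sSup_iff := by
          intro 𝒪 x y
          constructor
          · have key : ∀ x y, P.gen (sSup 𝒪) x y →
                Relation.TransGen (fun a b => ∃ U ∈ 𝒪, Relation.TransGen (P.gen U) a b) x y := by
              rintro _ _ ⟨K, p, hK, hp, a, b, h, rfl, rfl⟩
              let f : Opens Z → Opens K := fun A => ⟨p ⁻¹' A.1, A.2 K p hK hp⟩
              have e : f (sSup 𝒪) = sSup (f '' 𝒪) := by
                ext k
                simp [f]
              change K.circ.le (f (sSup 𝒪)) a b at h
              rw [e, K.circ.le_sSup_iff] at h
              refine Relation.TransGen.lift p ?_ _ _ h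
              rintro a b ⟨_, ⟨U, hU, rfl⟩, h⟩
              exact ⟨U, hU, .single ⟨K, p, hK, hp, a, b, h, rfl, rfl⟩⟩
            intro h
            induction h with
            | single h => exact key _ _ h
            | tail _ h ih => exact ih.trans (key _ _ h)
          · have key : ∀ x y, (∃ U ∈ 𝒪, Relation.TransGen (P.gen U) x y) →
                Relation.TransGen (P.gen (sSup 𝒪)) x y := by
              rintro x y ⟨U, hU, h⟩
              refine Relation.TransGen.mono ?_ _ _ h
              rintro _ _ ⟨K, p, hK, hp, a, b, h, rfl, rfl⟩
              exact ⟨K, p, hK, hp, a, b, K.circ.mono (fun k hk => le_sSup hU hk) h, rfl, rfl⟩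
            intro h
            induction h with
            | single h => exact key _ _ h
            | tail _ h ih => exact ih.trans (key _ _ h) } }

/-- Plots are stream maps. -/
theorem isStreamMap_plot {K : Strm.{u}} (hK : IsCH K) {p : K → Z} (hp : P.adm K p) :
    IsStreamMap (Y := P.stream) p :=
  ⟨⟨fun _ hA => hA K p hK hp⟩, fun _ a b h => .single ⟨K, p, hK, hp, a, b, h, rfl, rfl⟩⟩

/-- A function out of the final structure is a stream map if its composites with plots are. -/
theorem isStreamMap_of {T : Strm.{u}} (g : P.stream → T)
    (h : ∀ (K : Strm.{u}) (p : K → Z), IsCH K → P.adm K p → IsStreamMap (fun k => g (p k))) :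
    IsStreamMap g := by
  have hc : Continuous g := ⟨fun _ hA K p hK hp => hA.preimage (h K p hK hp).continuous⟩
  refine ⟨hc, fun U x y hxy => ?_⟩
  have key : ∀ x y, P.gen (⟨g ⁻¹' U, U.isOpen.preimage hc⟩ : Opens P.stream) x y → T.circ.le U (g x) (g y) := by
    rintro _ _ ⟨K, p, hK, hp, a, b, hab, rfl, rfl⟩
    exact (h K p hK hp).monotone U a b hab
  change Relation.TransGen _ x y at hxy
  induction hxy with
  | single h => exact key _ _ h
  | tail _ h ih => exact T.circ.trans ih (key _ _ h)

end Plots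

/-- The plots consisting of all stream maps to a stream. -/
def allPlots (X : Strm.{u}) : Plots X := ⟨fun _ p => IsStreamMap p, fun x => .const x⟩

/-- A stream with the final structure for stream maps from compact Hausdorff streams is a
k-stream. -/
theorem isKStream_of (X : Strm.{u})
    (ho : ∀ A : Set X, (∀ (K : Strm.{u}) (p : K → X), IsCH K → IsStreamMap p →
      IsOpen (p ⁻¹' A)) → IsOpen A)
    (hle : ∀ (A : Opens X) (x y : X), X.circ.le A x y →
      Relation.TransGen (fun x y => ∃ (K : Strm.{u}) (p : K → X) (_ : IsCH K)
        (hp : IsStreamMap p) (a b : K),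
        K.circ.le ⟨p ⁻¹' A.1, A.2.preimage hp.continuous⟩ a b ∧ p a = x ∧ p b = y) x y) :
    IsKStream X := by
  let G (t : Opens X × X × X) : Prop := ∃ (K : Strm.{u}) (p : K → X) (_ : IsCH K)
    (hp : IsStreamMap p) (a b : K),
    K.circ.le ⟨p ⁻¹' t.1.1, t.1.2.preimage hp.continuous⟩ a b ∧ p a = t.2.1 ∧ p b = t.2.2
  have hA : ∀ A : {A : Set X // ¬ IsOpen A}, ∃ (K : Strm.{u}) (p : K → X),
      IsCH K ∧ IsStreamMap p ∧ ¬ IsOpen (p ⁻¹' A.1) := by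
    rintro ⟨A, hA⟩
    by_contra hcon
    push Not at hcon
    exact hA (ho A hcon)
  choose KA pA hKA hpA hnA using hA
  have hG : ∀ t : {t : Opens X × X × X // G t}, ∃ (K : Strm.{u}) (p : K → X) (_ : IsCH K)
    (hp : IsStreamMap p) (a b : K),
    K.circ.le ⟨p ⁻¹' t.1.1.1, t.1.1.2.preimage hp.continuous⟩ a b ∧
      p a = t.1.2.1 ∧ p b = t.1.2.2 := fun t => t.2
  choose KG pG hKG hpG aG bG hleG haG hbG using hG
  let F : (X ⊕ {A : Set X // ¬ IsOpen A}) ⊕ {t : Opens X × X × X // G t} → Over X :=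
    Sum.elim (Sum.elim (fun x => Over.mk (Y := pt) (⟨fun _ => x, .const x⟩ : Strm.Hom _ _))
      (fun A => Over.mk (Y := KA A) (⟨pA A, hpA A⟩ : Strm.Hom _ _)))
      (fun t => Over.mk (Y := KG t) (⟨pG t, hpG t⟩ : Strm.Hom _ _))
  let D : InducedCategory (Over X) F ⥤ Strm.{u} := inducedFunctor F ⋙ Over.forget X
  let ι : D ⟶ (Functor.const _).obj X :=
    { app := fun j => (F j).hom
      naturality := fun i j f => by
        have := Over.w f.hom
        change f.hom.left ≫ (F j).hom = (F i).hom ≫ 𝟙 X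
        simp [this] }
  have hval : ∀ (s : Cocone D) (j : InducedCategory (Over X) F) (k : (F j).left),
      (s.ι.app (Sum.inl (Sum.inl ((F j).hom.toFun k)))).toFun PUnit.unit =
        (s.ι.app j).toFun k := by
    intro s j k
    let i : InducedCategory (Over X) F := Sum.inl (Sum.inl ((F j).hom.toFun k))
    let m : i ⟶ j := InducedCategory.homMk
      (Over.homMk (U := F i) (V := F j) (⟨fun _ => k, .const k⟩ : Strm.Hom _ _) rfl)
    have := s.w m
    exact (congrArg (fun q : Strm.Hom _ _ => q.toFun PUnit.unit) this).symm
  have hd : ∀ s : Cocone D, IsStreamMap (X := X) (Y := s.pt)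
      (fun x : X => (s.ι.app (Sum.inl (Sum.inl x))).toFun PUnit.unit) := by
    intro s
    have hc : Continuous (Y := s.pt)
        (fun x : X => (s.ι.app (Sum.inl (Sum.inl x))).toFun PUnit.unit) := by
      refine ⟨fun W hW => ?_⟩
      by_contra hn
      refine hnA ⟨_, hn⟩ ?_
      have h2 := hW.preimage (s.ι.app (Sum.inl (Sum.inr ⟨_, hn⟩))).isStreamMap.continuous
      refine (congrArg (IsOpen (X := KA ⟨_, hn⟩)) (Set.ext fun k => ?_)).mpr h2
      exact iff_of_eq (congrArg (· ∈ W) (hval s (Sum.inl (Sum.inr ⟨_, hn⟩)) k))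
    refine ⟨hc, fun U x y hxy => ?_⟩
    have key : ∀ x y, G (⟨_, U.isOpen.preimage hc⟩, x, y) →
        s.pt.circ.le U ((s.ι.app (Sum.inl (Sum.inl x))).toFun PUnit.unit)
          ((s.ι.app (Sum.inl (Sum.inl y))).toFun PUnit.unit) := by
      intro x y hg
      have h1 := hleG ⟨_, hg⟩
      have h2 := (s.ι.app (Sum.inr ⟨_, hg⟩)).isStreamMap.monotone U (aG ⟨_, hg⟩) (bG ⟨_, hg⟩)
        ((KG ⟨_, hg⟩).circ.mono (fun k hk => ?_) h1)
      · have e1 := hval s (Sum.inr ⟨_, hg⟩) (aG ⟨_, hg⟩)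
        have e2 := hval s (Sum.inr ⟨_, hg⟩) (bG ⟨_, hg⟩)
        rw [← e1, ← e2] at h2
        have e3 : (F (Sum.inr ⟨_, hg⟩)).hom.toFun (aG ⟨_, hg⟩) = x := haG ⟨_, hg⟩
        have e4 : (F (Sum.inr ⟨_, hg⟩)).hom.toFun (bG ⟨_, hg⟩) = y := hbG ⟨_, hg⟩
        rwa [e3, e4] at h2
      · exact (iff_of_eq (congrArg (· ∈ U) (hval s (Sum.inr ⟨_, hg⟩) k))).1 hk
    have := hle _ x y hxy
    induction this with
    | single h => exact key _ _ h
    | @tail b c h1 h ih =>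
      refine s.pt.circ.trans (ih ?_) (key _ _ h)
      clear ih h
      induction h1 with
      | single h =>
        obtain ⟨K, p, hK, hp, a, b, h, rfl, rfl⟩ := h
        exact hp.monotone _ _ _ h
      | tail _ h ih' =>
        obtain ⟨K, p, hK, hp, a, b, h, rfl, rfl⟩ := h
        exact X.circ.trans ih' (hp.monotone _ _ _ h)
  refine ⟨InducedCategory (Over X) F, inferInstance, ⟨D, ι, ?_⟩, ?_⟩
  · exact
      { desc := fun s => ⟨_, hd s⟩
        fac := fun s j => Strm.Hom.ext (funext fun k => hval s j k)
        uniq := fun s m hm => Strm.Hom.ext (funext fun x =>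
          congrArg (fun q : Strm.Hom pt s.pt => q.toFun PUnit.unit) (hm (Sum.inl (Sum.inl x)))) }
  · rintro ((x | A) | t)
    · exact pt_isCH
    · exact hKA A
    · exact hKG t

theorem Plots.isKStream {Z : Type u} (P : Plots Z) : IsKStream P.stream :=
  isKStream_of _ (fun _ h K p hK hp => h K p hK (P.isStreamMap_plot hK hp))
    (fun _ _ _ h => Relation.TransGen.mono
      (fun _ _ ⟨K, p, hK, hp, a, b, h, hx, hy⟩ =>
        ⟨K, p, hK, P.isStreamMap_plot hK hp, a, b, h, hx, hy⟩) _ _ h)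

theorem IsCH.isKStream {X : Strm.{u}} (h : IsCH X) : IsKStream X :=
  isKStream_of _ (fun _ hA => hA X _ h (.id X))
    (fun _ x y hxy => .single ⟨X, _, h, .id X, x, y, hxy, rfl, rfl⟩)

/-- The chaotic stream on two points. -/
def chaotic : Strm.{u} :=
  letI : TopologicalSpace (ULift.{u} Bool) := ⊤
  { carrier := ULift.{u} Bool
    top := ⊤
    circ :=
      { le := fun U x y => x ∈ U ∧ y ∈ U
        mem_of_le := fun h => h
        refl := fun h => ⟨h, h⟩
        trans := fun h h' => ⟨h.1, h'.2⟩
        le_sSup_iff := by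
          intro 𝒪 x y
          constructor
          · rintro ⟨hx, hy⟩
            obtain ⟨U, hU, hxU⟩ := Opens.mem_sSup.1 hx
            refine .single ⟨U, hU, hxU, ?_⟩
            rcases (TopologicalSpace.isOpen_top_iff _).1 U.2 with h | h
            · exact absurd hxU (by change x ∉ U.1; rw [h]; exact id)
            · change y ∈ U.1
              rw [h]; trivial
          · intro h
            induction h with
            | single h =>
              obtain ⟨U, hU, h1, h2⟩ := h
              exact ⟨Opens.mem_sSup.2 ⟨U, hU, h1⟩, Opens.mem_sSup.2 ⟨U, hU, h2⟩⟩
            | tail _ h ih =>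
              obtain ⟨U, hU, h1, h2⟩ := h
              exact ⟨ih.1, Opens.mem_sSup.2 ⟨U, hU, h2⟩⟩ } }

theorem isStreamMap_chaotic {X : Strm.{u}} (f : X → chaotic.{u}) : IsStreamMap f := by
  have hc : Continuous f := continuous_top
  exact ⟨hc, fun U x y h => X.circ.mem_of_le h⟩

/-- A k-stream has the final structure for stream maps from compact Hausdorff streams. -/
theorem IsKStream.isStreamMap {X : Strm.{u}} (hX : IsKStream X) {T : Strm.{u}} (g : X → T)
    (h : ∀ (K : Strm.{u}) (p : K → X), IsCH K → IsStreamMap p → IsStreamMap (fun k => g (p k))) :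
    IsStreamMap g := by
  classical
  obtain ⟨J, _, p, hp⟩ := hX
  let s : Cocone p.diag :=
    { pt := T
      ι :=
        { app := fun j =>
            (⟨_, h _ _ (hp j) (p.ι.app j).isStreamMap⟩ : Strm.Hom _ _)
          naturality := fun i j f => Strm.Hom.ext (funext fun k => congrArg g
            (congrArg (fun q : Strm.Hom _ _ => q.toFun k) (p.ι.naturality f))) } }
  have hfac : ∀ j k, (p.isColimit.desc s).toFun ((p.ι.app j).toFun k) =
      g ((p.ι.app j).toFun k) := fun j k =>
    congrArg (fun q : Strm.Hom _ _ => q.toFun k) (p.isColimit.fac s j)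
  have hsurj : ∀ x : X, ∃ j k, (p.ι.app j).toFun k = x := by
    let f₁ : X ⟶ chaotic := (⟨fun _ => (⟨true⟩ : ULift Bool), isStreamMap_chaotic _⟩ : Strm.Hom X chaotic)
    let f₂ : X ⟶ chaotic := (⟨fun x => (⟨decide (∃ j k, (p.ι.app j).toFun k = x)⟩ :
      ULift Bool), isStreamMap_chaotic _⟩ : Strm.Hom X chaotic)
    have e : f₁ = f₂ := p.isColimit.hom_ext fun j => Strm.Hom.ext (funext fun k => by
      exact congrArg (ULift.up (α := Bool)) (decide_eq_true
        (p := ∃ j' k', (p.ι.app j').toFun k' = (p.ι.app j).toFun k) ⟨j, k, rfl⟩).symm)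
    intro x
    have h2 : true = decide (∃ j k, (p.ι.app j).toFun k = x) :=
      congrArg (fun q : Strm.Hom X chaotic => ULift.down (α := Bool) (q.toFun x)) e
    exact of_decide_eq_true h2.symm
  have : (p.isColimit.desc s).toFun = g := by
    funext x
    obtain ⟨j, k, rfl⟩ := hsurj x
    exact hfac j k
  rw [← this]
  exact (p.isColimit.desc s).isStreamMap

theorem Plots.isStreamMap_into {Z : Type u} (P : Plots Z) {X : Strm.{u}} (hX : IsKStream X)
    (g : X → P.stream)
    (h : ∀ (K : Strm.{u}) (p : K → X), IsCH K → IsStreamMap p → P.adm K (fun k => g (p k))) :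
    IsStreamMap g :=
  hX.isStreamMap g fun K p hK hp => P.isStreamMap_plot hK (h K p hK hp)

theorem weakHausdorff_of_t2 {X : Type u} [TopologicalSpace X] [T2Space X] : WeakHausdorff X :=
  fun _ _ _ _ _ _ => inferInstance

theorem weakHausdorff_of_separating {X : Type u} [TopologicalSpace X]
    (h : ∀ x x' : X, x ≠ x' → ∃ (Y : Strm.{u}) (q : X → Y),
      WeakHausdorff Y ∧ Continuous q ∧ q x ≠ q x') : WeakHausdorff X := by
  intro K _ _ _ f hf
  refine ⟨fun a b hab => ?_⟩
  obtain ⟨Y, q, hY, hq, hne⟩ := h a b (fun h => hab (Subtype.ext h))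
  have := hY K (fun k => q (f k)) (hq.comp hf)
  let φ : Set.range f → Set.range (fun k => q (f k)) := fun z =>
    ⟨q z, by obtain ⟨z, k, rfl⟩ := z; exact ⟨k, rfl⟩⟩
  have hφ : Continuous φ := (hq.comp continuous_subtype_val).subtype_mk _
  exact separated_by_continuous hφ (fun h => hne (congrArg Subtype.val h))

/-! ## Spaces as streams -/

/-- A Hausdorff k-space, regarded as a stream with the initial circulation. -/
def ofSpace (Y : Type u) [TopologicalSpace Y] [UCompactlyGeneratedSpace.{u} Y] [T2Space Y] :
    𝒰.{u} where
  obj := ⟨Y, .initial Y⟩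
  property := by
    refine ⟨isKStream_of _ (fun A hA => ?_) ?_, weakHausdorff_of_t2 (X := Y)⟩
    · change IsOpen (X := Y) A
      refine UCompactlyGeneratedSpace.isOpen.{u} fun K f => ?_
      refine hA ⟨K, .initial K⟩ f ⟨inferInstanceAs (CompactSpace K), inferInstanceAs (T2Space K)⟩
        ⟨f.continuous, ?_⟩
      rintro U x _ ⟨rfl, hx⟩
      exact ⟨rfl, hx⟩
    · rintro A x _ ⟨rfl, hx⟩
      exact .single ⟨pt, fun _ => x, pt_isCH, .const (Y := ⟨Y, .initial Y⟩) x, PUnit.unit,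
        PUnit.unit, ⟨rfl, hx⟩, rfl, rfl⟩

namespace 𝒰

/-- A morphism of `𝒰` from a stream map. -/
def mk {X Y : 𝒰.{u}} (f : X.obj → Y.obj) (hf : IsStreamMap f) : X ⟶ Y :=
  ObjectProperty.homMk (⟨f, hf⟩ : Strm.Hom _ _)

/-- The function underlying a morphism of `𝒰`. -/
def fn {X Y : 𝒰.{u}} (f : X ⟶ Y) : X.obj → Y.obj := Strm.Hom.toFun f.hom

theorem isStreamMap {X Y : 𝒰.{u}} (f : X ⟶ Y) : IsStreamMap (fn f) :=
  Strm.Hom.isStreamMap f.hom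

theorem hom_ext {X Y : 𝒰.{u}} {f g : X ⟶ Y} (h : ∀ x, fn f x = fn g x) : f = g :=
  ObjectProperty.hom_ext _ (Strm.Hom.ext (funext h))

/-- A continuous map, regarded as a map of streams with initial circulations. -/
def ofMap {Y Z : Type u} [TopologicalSpace Y] [UCompactlyGeneratedSpace.{u} Y] [T2Space Y]
    [TopologicalSpace Z] [UCompactlyGeneratedSpace.{u} Z] [T2Space Z] (f : C(Y, Z)) :
    ofSpace Y ⟶ ofSpace Z :=
  mk f ⟨f.continuous, by rintro U x _ ⟨rfl, hx⟩; exact ⟨rfl, hx⟩⟩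

/-! ### Finite products -/

/-- The plots of a product are the pairs of stream maps. -/
def prodPlots (X Y : Strm.{u}) : Plots (X × Y) where
  adm _ p := IsStreamMap (fun k => (p k).1) ∧ IsStreamMap (fun k => (p k).2)
  const z := ⟨.const z.1, .const z.2⟩

/-- The product of streams, formed in k-streams. -/
def prod (X Y : Strm.{u}) : Strm.{u} := (prodPlots X Y).stream

theorem isStreamMap_fst (X Y : Strm.{u}) : IsStreamMap (X := prod X Y) (fun z : X × Y => z.1) :=
  (prodPlots X Y).isStreamMap_of _ fun _ _ _ hp => hp.1

theorem isStreamMap_snd (X Y : Strm.{u}) : IsStreamMap (X := prod X Y) (fun z : X × Y => z.2) :=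
  (prodPlots X Y).isStreamMap_of _ fun _ _ _ hp => hp.2

theorem isStreamMap_pair {T X Y : Strm.{u}} (hT : IsKStream T) {f : T → X} {g : T → Y}
    (hf : IsStreamMap f) (hg : IsStreamMap g) :
    IsStreamMap (Y := prod X Y) (fun t => ((f t, g t) : X × Y)) :=
  (prodPlots X Y).isStreamMap_into hT _ fun _ _ _ hp => ⟨hf.comp hp, hg.comp hp⟩

/-- The product in `𝒰`. -/
def prodObj (X Y : 𝒰.{u}) : 𝒰.{u} where
  obj := prod X.obj Y.obj
  property := ⟨(prodPlots _ _).isKStream,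
    weakHausdorff_of_separating (X := prod X.obj Y.obj) fun x x' hne => by
      by_cases h : Prod.fst x = Prod.fst x'
      · exact ⟨Y.obj, _, Y.property.2, (isStreamMap_snd _ _).continuous,
          fun h' => hne (Prod.ext h h')⟩
      · exact ⟨X.obj, _, X.property.2, (isStreamMap_fst _ _).continuous, h⟩⟩

instance : CartesianMonoidalCategory 𝒰.{u} :=
  .ofChosenFiniteProducts
    { cone := asEmptyCone (ofSpace PUnit)
      isLimit := IsTerminal.ofUniqueHom (fun _ => mk _ (.const PUnit.unit))
        (fun _ _ => hom_ext fun _ => rfl) }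
    (fun X Y =>
      { cone := BinaryFan.mk (P := prodObj X Y) (mk _ (isStreamMap_fst X.obj Y.obj))
          (mk _ (isStreamMap_snd X.obj Y.obj))
        isLimit := BinaryFan.isLimitMk
          (fun s => mk _ (isStreamMap_pair s.pt.property.1 (isStreamMap s.fst)
            (isStreamMap s.snd)))
          (fun _ => rfl) (fun _ => rfl)
          (fun _ _ h₁ h₂ => hom_ext fun x => Prod.ext
            (congrArg (fun q => fn q x) h₁) (congrArg (fun q => fn q x) h₂)) })

/-! ### Pullbacks -/

/-- The plots of a pullback are the compatible pairs of stream maps. -/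
def pullbackPlots {X Y W : 𝒰.{u}} (f : X ⟶ W) (g : Y ⟶ W) :
    Plots {z : X.obj × Y.obj // fn f z.1 = fn g z.2} where
  adm _ p := IsStreamMap (fun k => (p k).1.1) ∧ IsStreamMap (fun k => (p k).1.2)
  const z := ⟨.const z.1.1, .const z.1.2⟩

theorem isStreamMap_pullback_fst {X Y W : 𝒰.{u}} (f : X ⟶ W) (g : Y ⟶ W) :
    IsStreamMap (X := (pullbackPlots f g).stream)
      (fun z : {z : X.obj × Y.obj // fn f z.1 = fn g z.2} => z.1.1) :=
  (pullbackPlots f g).isStreamMap_of _ fun _ _ _ hp => hp.1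

theorem isStreamMap_pullback_snd {X Y W : 𝒰.{u}} (f : X ⟶ W) (g : Y ⟶ W) :
    IsStreamMap (X := (pullbackPlots f g).stream)
      (fun z : {z : X.obj × Y.obj // fn f z.1 = fn g z.2} => z.1.2) :=
  (pullbackPlots f g).isStreamMap_of _ fun _ _ _ hp => hp.2

/-- The pullback in `𝒰`. -/
def pullbackObj {X Y W : 𝒰.{u}} (f : X ⟶ W) (g : Y ⟶ W) : 𝒰.{u} where
  obj := (pullbackPlots f g).stream
  property := ⟨(pullbackPlots f g).isKStream,
    weakHausdorff_of_separating (X := (pullbackPlots f g).stream) fun x x' hne => by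
      by_cases h : (Subtype.val x).1 = (Subtype.val x').1
      · exact ⟨Y.obj, _, Y.property.2, (isStreamMap_pullback_snd f g).continuous,
          fun h' => hne (Subtype.ext (Prod.ext h h'))⟩
      · exact ⟨X.obj, _, X.property.2, (isStreamMap_pullback_fst f g).continuous, h⟩⟩

instance {X Y W : 𝒰.{u}} (f : X ⟶ W) (g : Y ⟶ W) : HasLimit (cospan f g) :=
  ⟨⟨{ cone := PullbackCone.mk (W := pullbackObj f g)
          (mk _ (isStreamMap_pullback_fst f g)) (mk _ (isStreamMap_pullback_snd f g))
          (hom_ext fun z => z.2)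
      isLimit := PullbackCone.IsLimit.mk _
        (fun s => mk
          (fun t => (⟨(fn s.fst t, fn s.snd t), congrArg (fun q => fn q t) s.condition⟩ :
            {z : X.obj × Y.obj // fn f z.1 = fn g z.2}))
          ((pullbackPlots f g).isStreamMap_into s.pt.property.1 _ fun _ _ _ hp =>
            ⟨(isStreamMap s.fst).comp hp, (isStreamMap s.snd).comp hp⟩))
        (fun _ => rfl) (fun _ => rfl)
        (fun _ _ h₁ h₂ => hom_ext fun x => Subtype.ext (Prod.ext
          (congrArg (fun q => fn q x) h₁) (congrArg (fun q => fn q x) h₂))) }⟩⟩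

instance : HasPullbacks 𝒰.{u} := hasPullbacks_of_hasLimit_cospan _

/-! ### Mapping streams -/

/-- Products with a fixed stream preserve final structures. -/
theorem isStreamMap_of_prod {Z : Type u} (P : Plots Z) {Y T : Strm.{u}} (g : Y → Z → T)
    (h : ∀ (K : Strm.{u}) (p : K → Z), IsCH K → P.adm K p →
      IsStreamMap (X := prod Y K) (fun z : Y × K => g z.1 (p z.2))) :
    IsStreamMap (X := prod Y P.stream) (fun z : Y × Z => g z.1 z.2) := by
  refine (prodPlots Y P.stream).isStreamMap_of _ fun L qp hL ⟨hq, hp⟩ => ?_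
  have := hL.1
  have := hL.2
  let q : L → Y := fun l => (qp l).1
  let p : L → Z := fun l => (qp l).2
  change IsStreamMap (fun l => g (q l) (p l))
  have hL₁ : ∀ z, IsStreamMap (fun l => g (q l) z) := fun z =>
    (h pt _ pt_isCH (P.const z)).comp
      (isStreamMap_pair (Y := pt) hL.isKStream hq (.const PUnit.unit))
  have hK₁ : ∀ (K : Strm.{u}) (r : K → Z), IsCH K → P.adm K r → ∀ l,
      IsStreamMap (fun k => g (q l) (r k)) := fun K r hK hr l =>
    (h K r hK hr).comp (isStreamMap_pair hK.isKStream (.const (q l)) (.id K))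
  have hLK : ∀ (K : Strm.{u}) (r : K → Z), IsCH K → P.adm K r →
      Continuous (fun z : L × K => g (q z.1) (r z.2)) := by
    intro K r hK hr
    have := hK.1
    have := hK.2
    let LK : Strm.{u} := ⟨L × K, .initial _⟩
    have hLK : IsCH LK :=
      ⟨inferInstanceAs (CompactSpace (L × K)), inferInstanceAs (T2Space (L × K))⟩
    have h₁ : IsStreamMap (X := LK) (fun z : L × K => q z.1) :=
      ⟨hq.continuous.comp continuous_fst, by rintro U x _ ⟨rfl, hx⟩; exact Y.circ.refl hx⟩
    have h₂ : IsStreamMap (X := LK) (fun z : L × K => z.2) :=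
      ⟨continuous_snd, by rintro U x _ ⟨rfl, hx⟩; exact K.circ.refl hx⟩
    exact ((h K r hK hr).comp (isStreamMap_pair hLK.isKStream h₁ h₂)).continuous
  -- Locally on `L`, the second argument may be replaced by all points of an open set.
  have hloc : ∀ (W : Opens T) (l : L), g (q l) (p l) ∈ W → ∃ (V : Opens P.stream) (A : Opens L),
      l ∈ A ∧ (∀ a ∈ A, p a ∈ V.1) ∧ ∀ a ∈ A, ∀ z ∈ V.1, g (q a) z ∈ W := by
    intro W l hl
    obtain ⟨N, hN, hlN, hNW⟩ := exists_compact_subset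
      (W.isOpen.preimage (hL₁ (p l)).continuous) (show l ∈ _ from hl)
    let V : Opens P.stream := ⟨{z | ∀ a ∈ N, g (q a) z ∈ W}, fun K r hK hr => by
      have hO : IsOpen {z : K × L | g (q z.2) (r z.1) ∈ W} :=
        W.isOpen.preimage ((hLK K r hK hr).comp continuous_swap)
      rw [isOpen_iff_mem_nhds]
      intro k hk
      exact hN.eventually_forall_of_forall_eventually fun a ha => hO.mem_nhds (hk a ha)⟩
    refine ⟨V, ⟨interior N ∩ p ⁻¹' V.1, isOpen_interior.inter (V.2.preimage hp.continuous)⟩,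
      ⟨hlN, fun a ha => hNW ha⟩, fun a ha => ha.2, fun a ha z hz => hz a (interior_subset ha.1)⟩
  have hc : Continuous (fun l => g (q l) (p l)) := by
    refine ⟨fun W hW => isOpen_iff_mem_nhds.2 fun l hl => ?_⟩
    obtain ⟨V, A, hlA, hAV, hA⟩ := hloc ⟨W, hW⟩ l hl
    exact Filter.mem_of_superset (A.isOpen.mem_nhds hlA) fun a ha => hA a ha _ (hAV a ha)
  refine ⟨hc, fun W l₁ l₂ hl => ?_⟩
  let 𝒪 : Set (Opens L) := {A | ∃ V : Opens P.stream,
    (∀ a ∈ A, p a ∈ V.1) ∧ ∀ a ∈ A, ∀ z ∈ V.1, g (q a) z ∈ W}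
  have hcov : (⟨_, W.isOpen.preimage hc⟩ : Opens L) ≤ sSup 𝒪 := by
    intro l hl
    obtain ⟨V, A, hlA, hAV, hA⟩ := hloc W l hl
    exact Opens.mem_sSup.2 ⟨A, ⟨V, hAV, hA⟩, hlA⟩
  have key : ∀ l₁ l₂, (∃ A ∈ 𝒪, L.circ.le A l₁ l₂) →
      T.circ.le W (g (q l₁) (p l₁)) (g (q l₂) (p l₂)) := by
    rintro l₁ l₂ ⟨A, ⟨V, hAV, hA⟩, hl⟩
    have hmem := L.circ.mem_of_le hl
    have hV : P.stream.circ.le V (p l₁) (p l₂) := hp.monotone V _ _ (L.circ.mono hAV hl)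
    have hstep : ∀ z z', P.gen V z z' → T.circ.le W (g (q l₁) z) (g (q l₁) z') := by
      rintro _ _ ⟨K, r, hK, hr, a, b, hab, rfl, rfl⟩
      exact (hK₁ K r hK hr l₁).monotone W a b
        (K.circ.mono (fun k hk => hA l₁ hmem.1 _ hk) hab)
    have h₁ : T.circ.le W (g (q l₁) (p l₁)) (g (q l₁) (p l₂)) := by
      change Relation.TransGen (P.gen V) (p l₁) (p l₂) at hV
      generalize p l₁ = z₁ at hV
      generalize p l₂ = z₂ at hV
      induction hV with
      | single h => exact hstep _ _ h
      | tail _ h ih => exact T.circ.trans ih (hstep _ _ h)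
    have h₂ : T.circ.le W (g (q l₁) (p l₂)) (g (q l₂) (p l₂)) :=
      (hL₁ (p l₂)).monotone W _ _
        (L.circ.mono (fun a ha => hA a ha _ (hAV l₂ hmem.2)) hl)
    exact T.circ.trans h₁ h₂
  have hl' := L.circ.mono hcov hl
  rw [L.circ.le_sSup_iff] at hl'
  clear hl
  induction hl' with
  | single h => exact key _ _ h
  | tail _ h ih => exact T.circ.trans ih (key _ _ h)

/-- The plots of a mapping stream: functions to the set of stream maps whose adjoints are stream
maps on the product. -/
def mapPlots (Y X : 𝒰.{u}) : Plots (Y ⟶ X) where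
  adm K p := IsStreamMap (X := prod Y.obj K) (Y := X.obj) (fun z : Y.obj × K => fn (p z.2) z.1)
  const f := (isStreamMap f).comp (isStreamMap_fst _ _)

theorem isStreamMap_eval (Y X : 𝒰.{u}) :
    IsStreamMap (X := prod Y.obj (mapPlots Y X).stream) (Y := X.obj)
      (fun z : Y.obj × (Y ⟶ X) => fn z.2 z.1) :=
  isStreamMap_of_prod (mapPlots Y X) (fun y f => fn f y) fun _ _ _ hp => hp

/-- The mapping stream `X ^ Y`. -/
def mapObj (Y X : 𝒰.{u}) : 𝒰.{u} where
  obj := (mapPlots Y X).stream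
  property := ⟨(mapPlots Y X).isKStream,
    weakHausdorff_of_separating (X := (mapPlots Y X).stream) fun f f' hne => by
      obtain ⟨y, hy⟩ : ∃ y, fn (X := Y) (Y := X) f y ≠ fn (X := Y) (Y := X) f' y := by
        by_contra hcon
        push Not at hcon
        exact hne (hom_ext hcon)
      exact ⟨X.obj, fun f => fn (X := Y) (Y := X) f y, X.property.2,
        ((isStreamMap_eval Y X).comp (isStreamMap_pair (mapPlots Y X).isKStream (.const y)
          (.id _))).continuous, hy⟩⟩

theorem isStreamMap_section {Y T X : 𝒰.{u}} (f : Y ⊗ T ⟶ X) (t : T.obj) :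
    IsStreamMap (X := Y.obj) (Y := X.obj)
      (fun y : Y.obj => fn f ((y, t) : Y.obj × T.obj)) :=
  (isStreamMap f).comp (isStreamMap_pair Y.property.1 (.id _) (.const t))

/-- The universal property of the mapping stream. -/
def mapEquiv (Y T X : 𝒰.{u}) : ((tensorLeft Y).obj T ⟶ X) ≃ (T ⟶ mapObj Y X) where
  toFun f := mk (fun t => (mk _ (isStreamMap_section f t) : Y ⟶ X))
    ((mapPlots Y X).isStreamMap_into T.property.1 _ fun K _ _ hp =>
      (isStreamMap f).comp ((isStreamMap_pair (prodPlots Y.obj K).isKStream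
        (isStreamMap_fst Y.obj K) (hp.comp (isStreamMap_snd Y.obj K)))))
  invFun g := mk (fun z : Y.obj × T.obj => fn (X := Y) (Y := X) (fn g z.2) z.1)
    ((isStreamMap_eval Y X).comp (isStreamMap_pair (prodPlots Y.obj T.obj).isKStream
      (isStreamMap_fst Y.obj T.obj) ((isStreamMap g).comp (isStreamMap_snd Y.obj T.obj))))
  left_inv _ := hom_ext fun _ => rfl
  right_inv _ := hom_ext fun _ => hom_ext fun _ => rfl

/-- `𝒰` is Cartesian closed. -/
instance : MonoidalClosed 𝒰.{u} where
  closed Y :=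
    { rightAdj := Adjunction.rightAdjointOfEquiv (F := tensorLeft Y) (mapEquiv Y)
        (fun _ _ _ _ _ => hom_ext fun _ => hom_ext fun _ => rfl)
      adj := Adjunction.adjunctionOfEquivRight (F := tensorLeft Y) (mapEquiv Y)
        (fun _ _ _ _ _ => hom_ext fun _ => hom_ext fun _ => rfl) }

/-! ### The unit interval and the non-negative reals -/

/-- The unit interval, with the initial circulation. -/
def 𝕀 : 𝒰.{u} := ofSpace (ULift.{u} unitInterval)

/-- The non-negative reals, with the initial circulation. -/
def ℝplus : 𝒰.{u} := ofSpace (ULift.{u} ℝ≥0)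

/-- The inclusion `{0} ↪ 𝕀`. -/
def zeroInterval : 𝟙_ 𝒰.{u} ⟶ 𝕀 := ofMap ⟨fun _ => ⟨0⟩, continuous_const⟩

/-- The inclusion `{0} ↪ ℝ₊`. -/
def zeroReal : 𝟙_ 𝒰.{u} ⟶ ℝplus := ofMap ⟨fun _ => ⟨0⟩, continuous_const⟩

/-- The stream map `max : ℝ₊ × ℝ₊ ⟶ ℝ₊`. -/
def maxReal : ℝplus.{u} ⊗ ℝplus ⟶ ℝplus :=
  mk (X := prodObj ℝplus ℝplus) (Y := ℝplus)
    (fun z : ULift.{u} ℝ≥0 × ULift.{u} ℝ≥0 => (⟨max z.1.down z.2.down⟩ : ULift.{u} ℝ≥0)) <|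
    (prodPlots ℝplus.obj ℝplus.obj).isStreamMap_of _ fun K p _ ⟨h₁, h₂⟩ => by
      have hc : Continuous (Y := ℝplus.obj)
          (fun k => (⟨max (p k).1.down (p k).2.down⟩ : ULift.{u} ℝ≥0)) :=
        continuous_uliftUp.comp ((continuous_uliftDown.comp h₁.continuous).max
          (continuous_uliftDown.comp h₂.continuous))
      refine ⟨hc, fun U a b hab => ?_⟩
      have e₁ := (h₁.monotone ⊤ a b (K.circ.mono le_top hab)).1
      have e₂ := (h₂.monotone ⊤ a b (K.circ.mono le_top hab)).1
      have e : p a = p b := Prod.ext e₁ e₂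
      exact ⟨by rw [e], (K.circ.mem_of_le hab).1⟩

/-! ## Moore paths -/

/-- The map `X ⟶ X ^ ℝ₊` sending a point to the constant path. -/
def constPath (X : 𝒰.{u}) : X ⟶ (ihom ℝplus).obj X :=
  MonoidalClosed.curry (snd ℝplus X)

/-- The map `X ^ ℝ₊ × ℝ₊ ⟶ X ^ ℝ₊` adjoint to `X ^ max`, sending `(ζ, t)` to
`s ↦ ζ (max s t)`. -/
def tailPath (X : 𝒰.{u}) : (ihom ℝplus).obj X ⊗ ℝplus ⟶ (ihom ℝplus).obj X :=
  MonoidalClosed.curry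
    (lift (lift (fst _ _) (snd _ _ ≫ snd _ _) ≫ maxReal) (snd _ _ ≫ fst _ _) ≫
      (ihom.ev ℝplus).app X)

/-- The map `X ^ ℝ₊ ⟶ X` evaluating a path at `0`. -/
def startPath (X : 𝒰.{u}) : (ihom ℝplus).obj X ⟶ X :=
  lift (toUnit _ ≫ zeroReal) (𝟙 _) ≫ (ihom.ev ℝplus).app X

theorem constPath_naturality {X Y : 𝒰.{u}} (h : X ⟶ Y) :
    constPath X ≫ (ihom ℝplus).map h = h ≫ constPath Y := by
  simp [constPath, ← MonoidalClosed.curry_natural_left, ← MonoidalClosed.curry_natural_right]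

theorem tailPath_naturality {X Y : 𝒰.{u}} (h : X ⟶ Y) :
    tailPath X ≫ (ihom ℝplus).map h = ((ihom ℝplus).map h ▷ ℝplus) ≫ tailPath Y := by
  rw [tailPath, tailPath, ← MonoidalClosed.curry_natural_left,
    ← MonoidalClosed.curry_natural_right]
  congr 1

theorem startPath_naturality {X Y : 𝒰.{u}} (h : X ⟶ Y) :
    (ihom ℝplus).map h ≫ startPath Y = startPath X ≫ h := by
  have e := ihom.ev_naturality ℝplus h
  rw [startPath, startPath, Category.assoc, ← e, ← Category.assoc, ← Category.assoc, comp_lift,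
    lift_whiskerLeft]
  simp

/-- The Moore path stream of `X`: the pairs `(ζ, t)` with `ζ` constant on `[t, ∞)`, as the
pullback of `X ^ ℝ₊ × ℝ₊ ⟶ X ^ ℝ₊ ⟵ X`. -/
def moorePathObj (X : 𝒰.{u}) : 𝒰.{u} := pullback (tailPath X) (constPath X)

/-- The map `(ζ, t) ↦ (ζ, t)`. -/
def mooreIncl (X : 𝒰.{u}) : moorePathObj X ⟶ (ihom ℝplus).obj X ⊗ ℝplus :=
  pullback.fst (tailPath X) (constPath X)

/-- The codomain of a Moore path `(ζ, t)`, the value of `ζ` on `[t, ∞)`. -/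
def mooreEnd (X : 𝒰.{u}) : moorePathObj X ⟶ X := pullback.snd (tailPath X) (constPath X)

theorem moore_condition (X : 𝒰.{u}) :
    mooreIncl X ≫ tailPath X = mooreEnd X ≫ constPath X := pullback.condition

/-- Maps to the Moore path stream. -/
def mooreLift {T X : 𝒰.{u}} (a : T ⟶ (ihom ℝplus).obj X ⊗ ℝplus) (b : T ⟶ X)
    (h : a ≫ tailPath X = b ≫ constPath X) : T ⟶ moorePathObj X := pullback.lift a b h

@[simp]
theorem mooreLift_incl {T X : 𝒰.{u}} (a : T ⟶ (ihom ℝplus).obj X ⊗ ℝplus) (b : T ⟶ X)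
    (h : a ≫ tailPath X = b ≫ constPath X) : mooreLift a b h ≫ mooreIncl X = a :=
  pullback.lift_fst _ _ _

@[simp]
theorem mooreLift_incl_assoc {T X : 𝒰.{u}} (a : T ⟶ (ihom ℝplus).obj X ⊗ ℝplus) (b : T ⟶ X)
    (h : a ≫ tailPath X = b ≫ constPath X) {S : 𝒰.{u}}
    (k : (ihom ℝplus).obj X ⊗ ℝplus ⟶ S) : mooreLift a b h ≫ mooreIncl X ≫ k = a ≫ k := by
  rw [← Category.assoc, mooreLift_incl]

@[simp]
theorem mooreLift_end {T X : 𝒰.{u}} (a : T ⟶ (ihom ℝplus).obj X ⊗ ℝplus) (b : T ⟶ X)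
    (h : a ≫ tailPath X = b ≫ constPath X) : mooreLift a b h ≫ mooreEnd X = b :=
  pullback.lift_snd _ _ _

@[simp]
theorem mooreLift_end_assoc {T X : 𝒰.{u}} (a : T ⟶ (ihom ℝplus).obj X ⊗ ℝplus) (b : T ⟶ X)
    (h : a ≫ tailPath X = b ≫ constPath X) {S : 𝒰.{u}}
    (k : X ⟶ S) : mooreLift a b h ≫ mooreEnd X ≫ k = b ≫ k := by
  rw [← Category.assoc, mooreLift_end]

theorem moore_hom_ext {T X : 𝒰.{u}} {a b : T ⟶ moorePathObj X}
    (h₁ : a ≫ mooreIncl X = b ≫ mooreIncl X) (h₂ : a ≫ mooreEnd X = b ≫ mooreEnd X) : a = b :=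
  pullback.hom_ext h₁ h₂

/-- The Moore path stream, as a functor. -/
def moorePath : 𝒰.{u} ⥤ 𝒰.{u} where
  obj X := moorePathObj X
  map {X Y} h := mooreLift (mooreIncl X ≫ (ihom ℝplus).map h ▷ ℝplus) (mooreEnd X ≫ h) (by
    rw [Category.assoc, Category.assoc, ← tailPath_naturality, ← constPath_naturality,
      ← Category.assoc, moore_condition, Category.assoc])
  map_id X := by apply moore_hom_ext <;> simp
  map_comp f g := by apply moore_hom_ext <;> simp

/-- The domain `ζ 0` of a Moore path `(ζ, t)`. -/
def mooreDom : moorePath.{u} ⟶ 𝟭 𝒰 where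
  app X := mooreIncl X ≫ fst _ _ ≫ startPath X
  naturality X Y h := by
    change mooreLift _ _ _ ≫ mooreIncl Y ≫ _ ≫ _ = (mooreIncl X ≫ _ ≫ _) ≫ h
    simp [startPath_naturality]

/-- The codomain of a Moore path. -/
def mooreCod : moorePath.{u} ⟶ 𝟭 𝒰 where
  app X := mooreEnd X
  naturality _ _ _ := mooreLift_end _ _ _

theorem mooreId_condition (X : 𝒰.{u}) :
    lift (constPath X) (toUnit X ≫ zeroReal) ≫ tailPath X = 𝟙 X ≫ constPath X := by
  rw [tailPath, constPath, ← MonoidalClosed.curry_natural_left,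
    ← MonoidalClosed.curry_natural_left]
  congr 1

/-- The identity Moore path at a point: the constant path, with `t = 0`. -/
def mooreId : 𝟭 𝒰.{u} ⟶ moorePath where
  app X := mooreLift (lift (constPath X) (toUnit X ≫ zeroReal)) (𝟙 X) (mooreId_condition X)
  naturality X Y h := by
    change h ≫ mooreLift _ _ _ = mooreLift _ _ _ ≫ mooreLift _ _ _
    apply moore_hom_ext
    · apply CartesianMonoidalCategory.hom_ext <;> simp [constPath_naturality]
    · simp

theorem mooreId_dom (X : 𝒰.{u}) : mooreId.app X ≫ mooreDom.app X = 𝟙 X := by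
  change mooreLift _ _ _ ≫ mooreIncl X ≫ fst _ _ ≫ startPath X = 𝟙 X
  rw [mooreLift_incl_assoc, lift_fst_assoc]
  have h := MonoidalClosed.uncurry_curry (snd ℝplus X)
  rw [MonoidalClosed.uncurry_eq] at h
  have h' : constPath X ≫ lift (toUnit _ ≫ zeroReal) (𝟙 _) =
      lift (toUnit _ ≫ zeroReal) (𝟙 X) ≫ ℝplus ◁ constPath X := by
    rw [comp_lift, lift_whiskerLeft]
    simp
  rw [startPath, ← Category.assoc, h', Category.assoc, constPath, h, lift_snd]

theorem mooreId_cod (X : 𝒰.{u}) : mooreId.app X ≫ mooreCod.app X = 𝟙 X :=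
  mooreLift_end _ _ _

end 𝒰

/-! ## Diagrams of streams

`G ⥤ 𝒰` is the category of `G`-streams; its products are formed objectwise, and a stream is
regarded as a constant `G`-stream. -/

section Diagrams

variable (G : Type w) [Category.{v} G]

/-- The inclusion `X × {0} ↪ X × 𝕀` of `G`-streams. -/
def cylinderZero (X : G ⥤ 𝒰.{u}) :
    X ⊗ (Functor.const G).obj (𝟙_ 𝒰.{u}) ⟶ X ⊗ (Functor.const G).obj 𝒰.𝕀 :=
  X ◁ (Functor.const G).map 𝒰.zeroInterval

variable {G} in
/-- An h-fibration of `G`-streams: a map with the right lifting property against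
`X × ({0} ↪ 𝕀)` for all `G`-streams `X`. -/
def IsHFibration {X Y : G ⥤ 𝒰.{u}} (f : X ⟶ Y) : Prop :=
  ∀ Z : G ⥤ 𝒰.{u}, HasLiftingProperty (cylinderZero G Z) f

/-- The Moore path `G`-stream, formed objectwise. -/
def diagPath : (G ⥤ 𝒰.{u}) ⥤ (G ⥤ 𝒰.{u}) :=
  (Functor.whiskeringRight G 𝒰.{u} 𝒰.{u}).obj 𝒰.moorePath

/-- The domain map `Π X ⟶ X` of `G`-streams. -/
def diagDom : diagPath.{w, v, u} G ⟶ 𝟭 _ :=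
  (Functor.whiskeringRight G 𝒰.{u} 𝒰.{u}).map 𝒰.mooreDom

/-- The codomain map `Π X ⟶ X` of `G`-streams. -/
def diagCod : diagPath.{w, v, u} G ⟶ 𝟭 _ :=
  (Functor.whiskeringRight G 𝒰.{u} 𝒰.{u}).map 𝒰.mooreCod

/-- The identity map `X ⟶ Π X` of `G`-streams. -/
def diagId : 𝟭 _ ⟶ diagPath.{w, v, u} G :=
  (Functor.whiskeringRight G 𝒰.{u} 𝒰.{u}).map 𝒰.mooreId

theorem diagId_dom (X : G ⥤ 𝒰.{u}) : (diagId G).app X ≫ (diagDom G).app X = 𝟙 X := by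
  ext1; funext g
  exact 𝒰.mooreId_dom (X.obj g)

theorem diagId_cod (X : G ⥤ 𝒰.{u}) : (diagId G).app X ≫ (diagCod G).app X = 𝟙 X := by
  ext1; funext g
  exact 𝒰.mooreId_cod (X.obj g)

variable {G}

/-- The mapping cocylinder `X ×_f Π Y` of `f : X ⟶ Y`, the pullback of `f` along the domain map
`Π Y ⟶ Y`. -/
def cocylinder {X Y : G ⥤ 𝒰.{u}} (f : X ⟶ Y) : G ⥤ 𝒰.{u} := pullback f ((diagDom G).app Y)

/-- The projection `X ×_f Π Y ⟶ X`. -/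
def cocylinderFst {X Y : G ⥤ 𝒰.{u}} (f : X ⟶ Y) : cocylinder f ⟶ X :=
  pullback.fst f ((diagDom G).app Y)

/-- The projection `X ×_f Π Y ⟶ Π Y`. -/
def cocylinderSnd {X Y : G ⥤ 𝒰.{u}} (f : X ⟶ Y) : cocylinder f ⟶ (diagPath G).obj Y :=
  pullback.snd f ((diagDom G).app Y)

/-- The map `L f : X ⟶ X ×_f Π Y` with components the identity of `X` and the composite of `f`
with the identity map `Y ⟶ Π Y`. -/
def cocylinderUnit {X Y : G ⥤ 𝒰.{u}} (f : X ⟶ Y) : X ⟶ cocylinder f :=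
  pullback.lift (𝟙 X) (f ≫ (diagId G).app Y) (by
    rw [Category.assoc, diagId_dom, Category.id_comp, Category.comp_id])

/-- The map `Γ f : X ×_f Π Y ⟶ Y`, the composite of the projection to `Π Y` with the codomain
map. -/
def cocylinderMap {X Y : G ⥤ 𝒰.{u}} (f : X ⟶ Y) : cocylinder f ⟶ Y :=
  cocylinderSnd f ≫ (diagCod G).app Y

theorem cocylinder_hom_ext {T X Y : G ⥤ 𝒰.{u}} {f : X ⟶ Y} {a b : T ⟶ cocylinder f}
    (h₁ : a ≫ cocylinderFst f = b ≫ cocylinderFst f)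
    (h₂ : a ≫ cocylinderSnd f = b ≫ cocylinderSnd f) : a = b :=
  pullback.hom_ext h₁ h₂

@[simp]
theorem cocylinderUnit_fst {X Y : G ⥤ 𝒰.{u}} (f : X ⟶ Y) :
    cocylinderUnit f ≫ cocylinderFst f = 𝟙 X := pullback.lift_fst _ _ _

@[simp]
theorem cocylinderUnit_fst_assoc {X Y S : G ⥤ 𝒰.{u}} (f : X ⟶ Y) (k : X ⟶ S) :
    cocylinderUnit f ≫ cocylinderFst f ≫ k = k := by
  rw [← Category.assoc, cocylinderUnit_fst, Category.id_comp]

@[simp]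
theorem cocylinderUnit_snd {X Y : G ⥤ 𝒰.{u}} (f : X ⟶ Y) :
    cocylinderUnit f ≫ cocylinderSnd f = f ≫ (diagId G).app Y := pullback.lift_snd _ _ _

@[simp]
theorem cocylinderUnit_snd_assoc {X Y S : G ⥤ 𝒰.{u}} (f : X ⟶ Y)
    (k : (diagPath G).obj Y ⟶ S) :
    cocylinderUnit f ≫ cocylinderSnd f ≫ k = f ≫ (diagId G).app Y ≫ k := by
  rw [← Category.assoc, cocylinderUnit_snd, Category.assoc]

theorem cocylinderUnit_map {X Y : G ⥤ 𝒰.{u}} (f : X ⟶ Y) :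
    cocylinderUnit f ≫ cocylinderMap f = f := by
  rw [cocylinderMap, cocylinderUnit_snd_assoc, diagId_cod, Category.comp_id]

/-- The map on mapping cocylinders induced by a commutative square. -/
def cocylinderSquare {f f' : Arrow (G ⥤ 𝒰.{u})} (h : f ⟶ f') :
    cocylinder f.hom ⟶ cocylinder f'.hom :=
  pullback.map _ _ _ _ h.left ((diagPath G).map h.right) h.right h.w.symm
    ((diagDom G).naturality h.right).symm

@[simp]
theorem cocylinderSquare_fst {f f' : Arrow (G ⥤ 𝒰.{u})} (h : f ⟶ f') :
    cocylinderSquare h ≫ cocylinderFst f'.hom = cocylinderFst f.hom ≫ h.left :=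
  pullback.lift_fst _ _ _

@[simp]
theorem cocylinderSquare_fst_assoc {f f' : Arrow (G ⥤ 𝒰.{u})} (h : f ⟶ f') {S : G ⥤ 𝒰.{u}}
    (k : f'.left ⟶ S) :
    cocylinderSquare h ≫ cocylinderFst f'.hom ≫ k = cocylinderFst f.hom ≫ h.left ≫ k := by
  rw [← Category.assoc, cocylinderSquare_fst, Category.assoc]

@[simp]
theorem cocylinderSquare_snd {f f' : Arrow (G ⥤ 𝒰.{u})} (h : f ⟶ f') :
    cocylinderSquare h ≫ cocylinderSnd f'.hom =
      cocylinderSnd f.hom ≫ (diagPath G).map h.right :=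
  pullback.lift_snd _ _ _

@[simp]
theorem cocylinderSquare_snd_assoc {f f' : Arrow (G ⥤ 𝒰.{u})} (h : f ⟶ f') {S : G ⥤ 𝒰.{u}}
    (k : (diagPath G).obj f'.right ⟶ S) :
    cocylinderSquare h ≫ cocylinderSnd f'.hom ≫ k =
      cocylinderSnd f.hom ≫ (diagPath G).map h.right ≫ k := by
  rw [← Category.assoc, cocylinderSquare_snd, Category.assoc]

end Diagrams

/-- A pointed endofunctor: an endofunctor with a natural transformation from the identity. -/
structure PointedEndofunctor (C : Type*) [Category* C] where
  toFunctor : C ⥤ C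
  unit : 𝟭 C ⟶ toFunctor

/-- The structure, on an object `c`, of an algebra over a pointed endofunctor `(T, η)`: a morphism
`T c ⟶ c` whose composite with `η_c : c ⟶ T c` is the identity. -/
structure PointedEndofunctor.AlgebraStr {C : Type*} [Category* C] (T : PointedEndofunctor C)
    (c : C) where
  act : T.toFunctor.obj c ⟶ c
  unit_act : T.unit.app c ≫ act = 𝟙 c

/-- The pointed endofunctor `Γ` on the arrows of `G`-streams: it sends `f : X ⟶ Y` to
`Γ f : X ×_f Π Y ⟶ Y`, and its unit at `f` is the square `(L f, 𝟙 Y)` from `f` to `Γ f`. -/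
def Γ (G : Type w) [Category.{v} G] : PointedEndofunctor (Arrow (G ⥤ 𝒰.{u})) where
  toFunctor :=
    { obj := fun f => Arrow.mk (cocylinderMap f.hom)
      map := fun {f f'} h => Arrow.homMk (cocylinderSquare h) h.right (by
        change cocylinderSquare h ≫ cocylinderSnd _ ≫ _ = (cocylinderSnd _ ≫ _) ≫ _
        rw [cocylinderSquare_snd_assoc, Category.assoc]
        exact congrArg _ ((diagCod G).naturality h.right))
      map_id := fun f => by
        ext1
        · apply cocylinder_hom_ext
          · exact (cocylinderSquare_fst _).trans
              ((Category.comp_id _).trans (Category.id_comp _).symm)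
          · refine (cocylinderSquare_snd _).trans ?_
            change _ ≫ (diagPath G).map (𝟙 _) = 𝟙 _ ≫ _
            rw [CategoryTheory.Functor.map_id, Category.comp_id, Category.id_comp]
        · rfl
      map_comp := fun h h' => by
        ext1
        · change cocylinderSquare (h ≫ h') = cocylinderSquare h ≫ cocylinderSquare h'
          apply cocylinder_hom_ext <;> simp
        · rfl }
  unit :=
    { app := fun f => Arrow.homMk (cocylinderUnit f.hom) (𝟙 _) (by
        change cocylinderUnit f.hom ≫ cocylinderMap f.hom = f.hom ≫ 𝟙 _
        rw [cocylinderUnit_map, Category.comp_id])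
      naturality := fun f f' h => by
        ext1
        · change h.left ≫ cocylinderUnit f'.hom = cocylinderUnit f.hom ≫ cocylinderSquare h
          apply cocylinder_hom_ext
          · simp
          · have e := (diagId G).naturality h.right
            simp only [Functor.id_map] at e
            simp [← e]
        · change h.right ≫ 𝟙 _ = 𝟙 _ ≫ h.right
          rw [Category.comp_id, Category.id_comp] }

end Streams

end

noncomputable section

namespace Streams

/-! An algebra structure on `f : X ⟶ Y` amounts to a map `a` from `X ×_f Π Y` to `X` over `Y` that
returns `x` on the pair of `x` and the identity path at `f x`. Such an `a` is a choice of transport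
along Moore paths, and the theorem compares transport with lifting of homotopies.

From lifting to transport, the homotopy `((x, (ζ, t)), s) ↦ ζ (max t 1 * s)` on the cocylinder
starts at `ζ 0 = f x`, so it has a lift starting at `x`. This lift is evaluated at `s = min t 1`.
Since `max t 1 * min t 1 = t`, the result lies over `ζ t`. Since the parameter vanishes for `t = 0`,
identity paths transport `x` to itself. Evaluating a lift of `ζ (t * s)` at `s = 1` would lose this
unit law, because a lift of a constant path need not be constant. The reparametrisation is carried
by `mooreHomotopy_zero`, `mooreHomotopy_param` and `mooreId_param`.

From transport to lifting, a homotopy `v` with initial lift `u` is cut off at each time `s`: the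
path `r ↦ v (z, min r s)` of length `s` runs from `v (z, 0) = f (u z)` to `v (z, s)`. Transporting
`u z` along it gives a lift of `v`. At `s = 0` the path is an identity path, so the lift begins with
`u`. This is the content of `moorePathOf_dom`, `moorePathOf_cod` and `zero_moorePathOf`.

All formulas are natural in the stream, so they pass objectwise to `G`-streams. -/

namespace 𝒰

/-! ### Reparametrisations between `𝕀` and `ℝ₊`. -/

/-- A continuous map of two variables, regarded as a map of streams with initial circulations. -/
def ofMap₂ {A B C : Type u} [TopologicalSpace A] [UCompactlyGeneratedSpace.{u} A] [T2Space A]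
    [TopologicalSpace B] [UCompactlyGeneratedSpace.{u} B] [T2Space B]
    [TopologicalSpace C] [UCompactlyGeneratedSpace.{u} C] [T2Space C] (f : C(A × B, C)) :
    ofSpace A ⊗ ofSpace B ⟶ ofSpace C :=
  mk (X := prodObj (ofSpace A) (ofSpace B)) (Y := ofSpace C) (fun z : A × B => f z) <|
    (prodPlots (ofSpace A).obj (ofSpace B).obj).isStreamMap_of _ fun K p _ ⟨h₁, h₂⟩ => by
      refine ⟨f.continuous.comp (h₁.continuous.prodMk h₂.continuous), fun U a b hab => ?_⟩
      -- Both factors carry the initial circulation, so related points of a plot have equal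
      -- components. Only this equality is used, which is why the relation may be enlarged to the
      -- whole space.
      have e : p a = p b := Prod.ext (h₁.monotone ⊤ a b (K.circ.mono le_top hab)).1
        (h₂.monotone ⊤ a b (K.circ.mono le_top hab)).1
      exact ⟨congrArg f e, (K.circ.mem_of_le hab).1⟩

/-- The inclusion `𝕀 ↪ ℝ₊`. -/
def inclInterval : 𝕀.{u} ⟶ ℝplus :=
  ofMap ⟨fun s => ⟨⟨s.down.1, s.down.2.1⟩⟩, continuous_uliftUp.comp
    ((continuous_subtype_val.comp continuous_uliftDown).subtype_mk _)⟩

/-- The stream map `ℝ₊ ⟶ 𝕀` sending `t` to `min t 1`. -/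
def clampReal : ℝplus.{u} ⟶ 𝕀 :=
  ofMap ⟨fun t => ⟨⟨min t.down 1, le_min t.down.2 zero_le_one, min_le_right _ _⟩⟩,
    continuous_uliftUp.comp (((NNReal.continuous_coe.comp continuous_uliftDown).min
      continuous_const).subtype_mk _)⟩

/-- The stream map `ℝ₊ × 𝕀 ⟶ 𝕀` sending `(r, s)` to `min r s`. -/
def minInterval : ℝplus.{u} ⊗ 𝕀 ⟶ 𝕀 :=
  ofMap₂ ⟨fun z => ⟨⟨min z.1.down z.2.down.1, le_min z.1.down.2 z.2.down.2.1,
      (min_le_right _ _).trans z.2.down.2.2⟩⟩,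
    continuous_uliftUp.comp (((NNReal.continuous_coe.comp
      (continuous_uliftDown.comp continuous_fst)).min (continuous_subtype_val.comp
        (continuous_uliftDown.comp continuous_snd))).subtype_mk _)⟩

/-- The stream map `ℝ₊ × 𝕀 ⟶ ℝ₊` sending `(t, s)` to `max t 1 * s`. -/
def scaleReal : ℝplus.{u} ⊗ 𝕀 ⟶ ℝplus :=
  ofMap₂ ⟨fun z => ⟨max z.1.down 1 * ⟨z.2.down.1, z.2.down.2.1⟩⟩, by
    have h : Continuous fun z : ULift.{u} ℝ≥0 × ULift.{u} unitInterval =>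
        (⟨z.2.down.1, z.2.down.2.1⟩ : ℝ≥0) :=
      (continuous_subtype_val.comp (continuous_uliftDown.comp continuous_snd)).subtype_mk _
    exact continuous_uliftUp.comp (((continuous_uliftDown.comp continuous_fst).max
      continuous_const).mul h)⟩

theorem scaleReal_zero (t : ULift.{u} ℝ≥0) : fn scaleReal (t, ⟨0⟩) = (⟨0⟩ : ULift.{u} ℝ≥0) :=
  congrArg ULift.up (mul_zero (max t.down 1))

/-- The identity `max t 1 * min t 1 = t` recovers the length without dividing by it, so the
parameter stays continuous at `t = 0`. -/
theorem scaleReal_clampReal (t : ULift.{u} ℝ≥0) : fn scaleReal (t, fn clampReal t) = t := by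
  refine congrArg ULift.up (NNReal.coe_injective ?_)
  refine (NNReal.coe_mul _ _).trans ?_
  rw [NNReal.coe_max]
  change max (t.down : ℝ) 1 * min (t.down : ℝ) 1 = t.down
  rw [max_mul_min, mul_one]

/-! ### Evaluation of Moore paths -/

/-- The length `t` of a Moore path `(ζ, t)`. -/
def mooreLength (X : 𝒰.{u}) : moorePath.obj X ⟶ ℝplus := mooreIncl X ≫ snd _ _

/-- The evaluation `(r, (ζ, t)) ↦ ζ r` of Moore paths. -/
def mooreEval (X : 𝒰.{u}) : ℝplus ⊗ moorePath.obj X ⟶ X :=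
  ℝplus ◁ (mooreIncl X ≫ fst _ _) ≫ (ihom.ev ℝplus).app X

theorem mooreMap_incl {X Y : 𝒰.{u}} (h : X ⟶ Y) :
    moorePath.map h ≫ mooreIncl Y = mooreIncl X ≫ (ihom ℝplus).map h ▷ ℝplus :=
  mooreLift_incl _ _ _

/-- Applying `Π h` changes `ζ` to `h ∘ ζ` and leaves `t` alone. This and `mooreMap_eval` give the
naturality needed to assemble the homotopy and its parameter over `G`. -/
theorem mooreMap_length {X Y : 𝒰.{u}} (h : X ⟶ Y) :
    moorePath.map h ≫ mooreLength Y = mooreLength X :=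
  hom_ext fun p => congrArg
    (fun q : moorePath.obj X ⟶ (ihom ℝplus).obj Y ⊗ ℝplus => (fn q p).2) (mooreMap_incl h)

theorem mooreMap_eval {X Y : 𝒰.{u}} (h : X ⟶ Y) :
    ℝplus ◁ moorePath.map h ≫ mooreEval Y = mooreEval X ≫ h :=
  hom_ext fun p => congrArg
    (fun q : moorePath.obj X ⟶ (ihom ℝplus).obj Y ⊗ ℝplus =>
      fn (X := ℝplus) (Y := Y) (fn q p.2).1 p.1) (mooreMap_incl h)

/-- The homotopy `((ζ, t), s) ↦ ζ (max t 1 * s)` from the domain map. -/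
def mooreHomotopy (X : 𝒰.{u}) : moorePath.obj X ⊗ 𝕀 ⟶ X :=
  lift (mooreLength X ▷ 𝕀 ≫ scaleReal) (fst _ _) ≫ mooreEval X

/-- The parameter `min t 1`, at which the homotopy reaches the codomain. -/
def mooreParam (X : 𝒰.{u}) : moorePath.obj X ⟶ 𝕀 := mooreLength X ≫ clampReal

theorem mooreMap_param {X Y : 𝒰.{u}} (h : X ⟶ Y) :
    moorePath.map h ≫ mooreParam Y = mooreParam X := by
  rw [mooreParam, ← Category.assoc, mooreMap_length, mooreParam]

theorem mooreMap_homotopy {X Y : 𝒰.{u}} (h : X ⟶ Y) :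
    moorePath.map h ▷ 𝕀 ≫ mooreHomotopy Y = mooreHomotopy X ≫ h := by
  rw [mooreHomotopy, mooreHomotopy, Category.assoc, ← mooreMap_eval, ← mooreMap_length h,
    comp_whiskerRight]
  rfl

theorem mooreHomotopy_zero (X : 𝒰.{u}) :
    moorePath.obj X ◁ zeroInterval ≫ mooreHomotopy X = fst _ _ ≫ mooreDom.app X := by
  refine hom_ext fun p => ?_
  change fn (X := ℝplus) (Y := X) (fn (mooreIncl X) p.1).1 _ =
    fn (X := ℝplus) (Y := X) (fn (mooreIncl X) p.1).1 _
  exact congrArg _ (scaleReal_zero _)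

/-- At parameter `min t 1` the path is evaluated at `t`. Because `mooreCod` is the second projection
of the pullback rather than an evaluation, the defining equation of `Π X` is needed to identify it
with `ζ t`. -/
theorem mooreHomotopy_param (X : 𝒰.{u}) :
    lift (𝟙 _) (mooreParam X) ≫ mooreHomotopy X = mooreCod.app X := by
  refine hom_ext fun p => ?_
  -- The paths `r ↦ ζ (max r t)` and the constant path at the end point are compared at `r = t`,
  -- where the former gives `ζ (max t t)`.
  have e := congrArg (fun q => fn (X := ℝplus) (Y := X) (fn q p) (fn (mooreLength X) p))
    (moore_condition X)
  refine Eq.trans ?_ e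
  change fn (X := ℝplus) (Y := X) (fn (mooreIncl X) p).1 _ =
    fn (X := ℝplus) (Y := X) (fn (mooreIncl X) p).1 _
  exact congrArg _ ((scaleReal_clampReal _).trans (congrArg ULift.up (max_self _).symm))

/-- Identity paths have length `0`, so their parameter is `0`. There a lifted homotopy is
prescribed, which is the source of the unit law. -/
theorem mooreId_param (X : 𝒰.{u}) :
    mooreId.app X ≫ mooreParam X = toUnit X ≫ zeroInterval := by
  have e : mooreId.app X ≫ mooreLength X = toUnit X ≫ zeroReal := by
    change mooreLift _ _ _ ≫ mooreIncl X ≫ snd _ _ = _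
    rw [mooreLift_incl_assoc, lift_snd]
  rw [mooreParam, ← Category.assoc, e]
  refine hom_ext fun x => congrArg ULift.up (Subtype.ext ?_)
  exact min_eq_left zero_le_one

/-! ### Moore paths from homotopies -/

/-- The stream map `ℝ₊ × (Z × 𝕀) ⟶ Z × 𝕀` sending `(r, (z, s))` to `(z, min r s)`. -/
def truncate (Z : 𝒰.{u}) : ℝplus ⊗ (Z ⊗ 𝕀) ⟶ Z ⊗ 𝕀 :=
  lift (snd _ _ ≫ fst _ _) (lift (fst _ _) (snd _ _ ≫ snd _ _) ≫ minInterval)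

/-- The path cut off at time `s` is constant from `s` on, because `min (max r s) s = s`, and its
final value is `v (z, s)`. -/
theorem moorePathOf_condition {Z Y : 𝒰.{u}} (v : Z ⊗ 𝕀 ⟶ Y) :
    lift (MonoidalClosed.curry (truncate Z ≫ v)) (snd Z 𝕀 ≫ inclInterval) ≫ tailPath Y =
      v ≫ constPath Y := by
  refine hom_ext fun p => hom_ext fun r => ?_
  change fn v (p.1, _) = fn v p
  congr 1
  refine Prod.ext rfl (congrArg ULift.up (Subtype.ext ?_))
  change min (max _ _) _ = _
  exact min_eq_right (le_max_right _ _)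

/-- The family of Moore paths `(z, s) ↦ (r ↦ v (z, min r s), s)` defined by a homotopy `v`. -/
def moorePathOf {Z Y : 𝒰.{u}} (v : Z ⊗ 𝕀 ⟶ Y) : Z ⊗ 𝕀 ⟶ moorePathObj Y :=
  mooreLift _ v (moorePathOf_condition v)

theorem moorePathOf_naturality {Z Z' Y Y' : 𝒰.{u}} {v : Z ⊗ 𝕀 ⟶ Y} {v' : Z' ⊗ 𝕀 ⟶ Y'}
    {k : Z ⟶ Z'} {h : Y ⟶ Y'} (e : k ▷ 𝕀 ≫ v' = v ≫ h) :
    k ▷ 𝕀 ≫ moorePathOf v' = moorePathOf v ≫ moorePath.map h := by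
  change _ ≫ mooreLift _ _ _ = mooreLift _ _ _ ≫ mooreLift _ _ _
  apply moore_hom_ext
  · rw [Category.assoc, mooreLift_incl, Category.assoc, mooreLift_incl, mooreLift_incl_assoc]
    -- The lengths agree by definition, since `k ▷ 𝕀` fixes the time coordinate; the paths agree by
    -- evaluating `e` at the truncated time.
    refine hom_ext fun p => Prod.ext (hom_ext fun r => ?_) rfl
    exact congrArg (fun q => fn q (fn (truncate Z) (r, p))) e
  · rw [Category.assoc, mooreLift_end, Category.assoc, mooreLift_end, mooreLift_end_assoc, e]

/-- Every cut-off path starts at `v (z, min 0 s) = v (z, 0)`, independently of `s`. This is the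
compatibility that pairs it with `u z` in the cocylinder of `f`. -/
theorem moorePathOf_dom {Z Y X : 𝒰.{u}} {v : Z ⊗ 𝕀 ⟶ Y} {u : Z ⊗ 𝟙_ 𝒰.{u} ⟶ X} {f : X ⟶ Y}
    (e : u ≫ f = Z ◁ zeroInterval ≫ v) :
    moorePathOf v ≫ mooreDom.app Y = lift (fst _ _) (toUnit _) ≫ u ≫ f := by
  change mooreLift _ _ _ ≫ mooreIncl Y ≫ fst _ _ ≫ startPath Y = _
  rw [mooreLift_incl_assoc, e]
  refine hom_ext fun p => ?_
  change fn v (p.1, _) = fn v (p.1, _)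
  congr 2
  refine congrArg ULift.up (Subtype.ext ?_)
  exact min_eq_left p.2.down.2.1

theorem moorePathOf_cod {Z Y : 𝒰.{u}} (v : Z ⊗ 𝕀 ⟶ Y) :
    moorePathOf v ≫ mooreCod.app Y = v := mooreLift_end _ _ _

/-- Cutting off at time `0` leaves `r ↦ v (z, min r 0)`, a constant path of length exactly `0`.
Length zero matters: the unit law says nothing about constant paths of positive length. -/
theorem zero_moorePathOf {Z Y : 𝒰.{u}} (v : Z ⊗ 𝕀 ⟶ Y) :
    Z ◁ zeroInterval ≫ moorePathOf v = (Z ◁ zeroInterval ≫ v) ≫ mooreId.app Y := by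
  change _ ≫ mooreLift _ _ _ = _ ≫ mooreLift _ _ _
  apply moore_hom_ext
  · rw [Category.assoc, mooreLift_incl, Category.assoc, mooreLift_incl]
    refine hom_ext fun p => Prod.ext (hom_ext fun r => ?_) (congrArg ULift.up rfl)
    change fn v (p.1, _) = fn v (p.1, _)
    congr 2
    refine congrArg ULift.up (Subtype.ext ?_)
    exact min_eq_right r.down.2
  · rw [Category.assoc, mooreLift_end, Category.assoc, mooreLift_end, Category.comp_id]

end 𝒰

/-! ### Diagrams of streams -/

variable {G : Type w} [Category.{v} G]

/-- The homotopy from the domain map of the Moore path `G`-stream. -/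
def diagHomotopy (X : G ⥤ 𝒰.{u}) : (diagPath G).obj X ⊗ (Functor.const G).obj 𝒰.𝕀 ⟶ X where
  app g := 𝒰.mooreHomotopy (X.obj g)
  naturality _ _ k := 𝒰.mooreMap_homotopy (X.map k)

/-- The parameters at which the homotopy reaches the codomain map. -/
def diagParam (X : G ⥤ 𝒰.{u}) : (diagPath G).obj X ⟶ (Functor.const G).obj 𝒰.𝕀 where
  app g := 𝒰.mooreParam (X.obj g)
  naturality _ _ k := (𝒰.mooreMap_param (X.map k)).trans (Category.comp_id _).symm

theorem cylinderZero_diagHomotopy (X : G ⥤ 𝒰.{u}) :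
    cylinderZero G ((diagPath G).obj X) ≫ diagHomotopy X = fst _ _ ≫ (diagDom G).app X := by
  ext1; funext g
  exact 𝒰.mooreHomotopy_zero (X.obj g)

theorem diagHomotopy_param (X : G ⥤ 𝒰.{u}) :
    lift (𝟙 _) (diagParam X) ≫ diagHomotopy X = (diagCod G).app X := by
  ext1; funext g
  exact 𝒰.mooreHomotopy_param (X.obj g)

theorem diagId_param (X : G ⥤ 𝒰.{u}) :
    (diagId G).app X ≫ diagParam X =
      (toUnit X : X ⟶ (Functor.const G).obj (𝟙_ 𝒰.{u})) ≫
        (Functor.const G).map 𝒰.zeroInterval := by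
  ext1; funext g
  exact 𝒰.mooreId_param (X.obj g)

/-- The family of Moore paths defined by a homotopy of `G`-streams. -/
def diagPathOf {Z Y : G ⥤ 𝒰.{u}} (v : Z ⊗ (Functor.const G).obj 𝒰.𝕀 ⟶ Y) :
    Z ⊗ (Functor.const G).obj 𝒰.𝕀 ⟶ (diagPath G).obj Y where
  app g := 𝒰.moorePathOf (Z := Z.obj g) (v.app g)
  naturality _ _ k := 𝒰.moorePathOf_naturality (k := Z.map k) (v.naturality k)

theorem diagPathOf_dom {Z X Y : G ⥤ 𝒰.{u}} {v : Z ⊗ (Functor.const G).obj 𝒰.𝕀 ⟶ Y}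
    {u : Z ⊗ (Functor.const G).obj (𝟙_ 𝒰.{u}) ⟶ X} {f : X ⟶ Y}
    (e : u ≫ f = cylinderZero G Z ≫ v) :
    (lift (fst _ _) (toUnit _) ≫ u) ≫ f = diagPathOf v ≫ (diagDom G).app Y := by
  ext1; funext g
  exact (𝒰.moorePathOf_dom (Z := Z.obj g) (congrArg (fun q => q.app g) e)).symm

theorem diagPathOf_cod {Z Y : G ⥤ 𝒰.{u}} (v : Z ⊗ (Functor.const G).obj 𝒰.𝕀 ⟶ Y) :
    diagPathOf v ≫ (diagCod G).app Y = v := by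
  ext1; funext g
  exact 𝒰.moorePathOf_cod (Z := Z.obj g) (v.app g)

theorem cylinderZero_diagPathOf {Z Y : G ⥤ 𝒰.{u}} (v : Z ⊗ (Functor.const G).obj 𝒰.𝕀 ⟶ Y) :
    cylinderZero G Z ≫ diagPathOf v = (cylinderZero G Z ≫ v) ≫ (diagId G).app Y := by
  ext1; funext g
  exact 𝒰.zero_moorePathOf (Z := Z.obj g) (v.app g)

/-! ### Algebra structures and homotopy lifting. -/

theorem cocylinder_condition {X Y : G ⥤ 𝒰.{u}} (f : X ⟶ Y) :
    cocylinderFst f ≫ f = cocylinderSnd f ≫ (diagDom G).app Y := pullback.condition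

/-- A lift of the canonical homotopy on the mapping cocylinder defines an algebra structure. -/
theorem IsHFibration.exists_algebra {X Y : G ⥤ 𝒰.{u}} {f : X ⟶ Y} (hf : IsHFibration f) :
    ∃ a : cocylinder f ⟶ X, cocylinderUnit f ≫ a = 𝟙 X ∧ a ≫ f = cocylinderMap f := by
  have := hf (cocylinder f)
  -- The lifting problem is the universal one: `x` is the initial value over the homotopy running
  -- along `ζ`, and the square commutes because `f x = ζ 0` on the cocylinder.
  have sq : CommSq (fst _ _ ≫ cocylinderFst f) (cylinderZero G (cocylinder f)) f
      (cocylinderSnd f ▷ _ ≫ diagHomotopy Y) := ⟨by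
    rw [Category.assoc, cocylinder_condition, cylinderZero,
      whisker_exchange_assoc]
    change _ = _ ≫ cylinderZero G _ ≫ _
    rw [cylinderZero_diagHomotopy, whiskerRight_fst_assoc]⟩
  -- The action is the lift evaluated at the length-dependent parameter `min t 1`.
  refine ⟨lift (𝟙 _) (cocylinderSnd f ≫ diagParam Y) ≫ sq.lift, ?_, ?_⟩
  · have e : cocylinderUnit f ≫ lift (𝟙 _) (cocylinderSnd f ≫ diagParam Y) =
        lift (cocylinderUnit f) (toUnit X) ≫ cylinderZero G (cocylinder f) := by
      rw [comp_lift, cylinderZero]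
      erw [lift_whiskerLeft]
      rw [Category.comp_id, cocylinderUnit_snd_assoc, diagId_param, ← Category.assoc]
      congr 1
    rw [← Category.assoc, e, Category.assoc, sq.fac_left]
    erw [lift_fst_assoc]
    exact cocylinderUnit_fst f
  · have e : lift (𝟙 _) (cocylinderSnd f ≫ diagParam Y) ≫ cocylinderSnd f ▷ _ =
        cocylinderSnd f ≫ lift (𝟙 _) (diagParam Y) := by
      rw [lift_whiskerRight, comp_lift, Category.id_comp, Category.comp_id]
    rw [Category.assoc, sq.fac_right, ← Category.assoc, e, Category.assoc, diagHomotopy_param,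
      cocylinderMap]

/-- An algebra structure lifts homotopies. -/
theorem isHFibration_of_algebra {X Y : G ⥤ 𝒰.{u}} {f : X ⟶ Y} {a : cocylinder f ⟶ X}
    (h₁ : cocylinderUnit f ≫ a = 𝟙 X) (h₂ : a ≫ f = cocylinderMap f) : IsHFibration f := by
  refine fun Z => ⟨fun {p q} sq => ?_⟩
  -- The map `k` sends `(z, s)` to `p z` together with the path from `q (z, 0)` to `q (z, s)`;
  -- following it with `a` gives the required filler.
  let k : Z ⊗ (Functor.const G).obj 𝒰.𝕀 ⟶ cocylinder f :=
    pullback.lift (lift (fst _ _) (toUnit _) ≫ p) (diagPathOf q) (diagPathOf_dom sq.w)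
  have k₁ : k ≫ cocylinderFst f = lift (fst _ _) (toUnit _) ≫ p := pullback.lift_fst _ _ _
  have k₂ : k ≫ cocylinderSnd f = diagPathOf q := pullback.lift_snd _ _ _
  -- At `s = 0` the map `k` lands in the image of `L f`, where `h₁` determines `a`.
  have e : cylinderZero G Z ≫ k = p ≫ cocylinderUnit f := by
    apply cocylinder_hom_ext
    · rw [Category.assoc, k₁, Category.assoc, cocylinderUnit_fst, Category.comp_id]
      rfl
    · rw [Category.assoc, k₂, Category.assoc, cocylinderUnit_snd, cylinderZero_diagPathOf,
        ← sq.w, Category.assoc]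
  refine ⟨⟨⟨k ≫ a, ?_, ?_⟩⟩⟩
  · rw [← Category.assoc, e, Category.assoc, h₁, Category.comp_id]
  · rw [Category.assoc, h₂, cocylinderMap, ← Category.assoc, k₂, diagPathOf_cod]

end Streams

end


theorem mainTheorem3 {G : Type w} [Category.{v} G] {X Y : G ⥤ Streams.𝒰.{u}} (f : X ⟶ Y) :
    Streams.IsHFibration f ↔ Nonempty ((Streams.Γ G).AlgebraStr (Arrow.mk f)) := by
  constructor
  · intro hf
    obtain ⟨a, h₁, h₂⟩ := hf.exists_algebra
    refine ⟨⟨Arrow.homMk a (𝟙 Y) (h₂.trans (Category.comp_id _).symm), ?_⟩⟩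
    ext1
    · exact h₁
    · exact Category.comp_id (𝟙 Y)
  · rintro ⟨⟨act, hact⟩⟩
    have e₁ : Streams.cocylinderUnit f ≫ act.left = 𝟙 X := congrArg CommaMorphism.left hact
    -- The unit of `Γ` is the identity on codomains, so the unit law forces the codomain component
    -- of the action to be the identity. Hence `act.left` is a map over `Y`.
    have e₂ : 𝟙 Y ≫ act.right = 𝟙 Y := congrArg CommaMorphism.right hact
    refine Streams.isHFibration_of_algebra e₁ (act.w.trans ?_)
    exact (congrArg (Streams.cocylinderMap f ≫ ·) ((Category.id_comp _).symm.trans e₂)).trans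
      (Category.comp_id _)
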